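/- **Angle coherence under line contingency.** Consider a finite undirected weighted network whose nodes are split into a nonempty set $\mathcal N_g$ of synchronous machines (active nodes) and a set $\mathcal N_c$ of passive nodes, with line susceptances $b_{ij}=b_{ji}\ge 0$, $b_{ii}=0$ (there is a line $i$–$j$ iff $b_{ij}>0$), and Laplacian $$\boldsymbol L^{\rm ph}=\sum_{i<j}b_{ij}\,\boldsymbol e_{(i,j)}\boldsymbol e_{(i,j)}^\top=\begin{pmatrix}\boldsymbol L^{gg}&\boldsymbol L^{gc}\\ \boldsymbol L^{cg}&\boldsymbol L^{cc}\end{pmatrix},\qquad \boldsymbol e_{(i,j)}=\boldsymbol e_i-\boldsymbol e_j .$$ Let $\boldsymbol P=\boldsymbol L^{\rm ph}\boldsymbol\theta^\star$ be power injections with operating point $\boldsymbol\theta^\star=(\boldsymbol\theta^\star_g,\boldsymbol\theta^\star_c)$. Put $\boldsymbol L_{\rm red}=\boldsymbol L^{gg}-\boldsymbol L^{gc}[\boldsymbol L^{cc}]^{-1}\boldsymbol L^{cg}$ and $\boldsymbol P_{\rm red}=\boldsymbol P_g-\boldsymbol L^{gc}[\boldsymbol L^{cc}]^{-1}\boldsymbol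 P_c$. Let $\alpha$–$\beta$ be a line whose removal does not disconnect the network, and let $\boldsymbol L_{\rm red}'$, $\boldsymbol P_{\rm red}'$ be the same quantities formed with $\boldsymbol L^{\rm ph}-b_{\alpha\beta}\boldsymbol e_{(\alpha,\beta)}\boldsymbol e_{(\alpha,\beta)}^\top$ in place of $\boldsymbol L^{\rm ph}$ and the same $\boldsymbol P$. Let $d,\gamma>0$, $m=d/\gamma$ and $\tau\in\mathbb R$. For $\epsilon>0$ let $\boldsymbol\varphi_g=\boldsymbol\varphi_{g,\epsilon}$ be the deviation of the machine angles from $\boldsymbol\theta_g^\star$ in the regularized Kron-reduced swing dynamics under the Dirac-$\delta$ fault of the line at $t=0$, $$m\ddot{\boldsymbol\varphi}_g=-d\,\dot{\boldsymbol\varphi}_g-(\boldsymbol L_{\rm red}+\epsilon\mathbb I)\boldsymbol\varphi_g+\tau\,\delta(t)\big[(\boldsymbol P_{\rm red}'-\boldsymbol P_{\rm red})-(\boldsymbol L_{\rm red}'-\boldsymbol L_{\rm red})(\boldsymbol\theta_g^\star+\boldsymbol\varphi_g)\big],$$ with $\boldsymbol\varphi_g$ continuous and the system at rest, $(\boldsymbol\varphi_g,\dot{\boldsymbol\varphi}_g)=(0,0)$,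 before the fault. Then $\boldsymbol L^{cc}$ and its counterpart without the line are invertible, the denominators below are nonzero, and for every $\epsilon>0$ the response $\boldsymbol\varphi_{g,\epsilon}$ exists, is unique, and $\boldsymbol\varphi_{g,\epsilon}^\top\boldsymbol\varphi_{g,\epsilon}$ is integrable on $(0,\infty)$. The angle coherence measure $\mathcal P_{\boldsymbol\varphi}=\lim_{\epsilon\to0^+}\int_0^\infty\boldsymbol\varphi_{g,\epsilon}^\top\boldsymbol\varphi_{g,\epsilon}\,dt$ exists and equals $$\mathcal P_{\boldsymbol\varphi}=\frac{P_{\alpha,\beta}^2\tau^2}{2d}\,\Omega_{\alpha\beta}$$ if the faulted line connects two synchronous machines; $$\mathcal P_{\boldsymbol\varphi}=\frac{P_{\alpha,\beta}^2\tau^2}{2d}\;\frac{\Omega_{\alpha\beta}-\boldsymbol e_{(\alpha,\beta)}^\top[\boldsymbol L^{cc}]^{-1}\boldsymbol e_{(\alpha,\beta)}}{\big[1-b_{\alpha\beta}\,\boldsymbol e_{(\alpha,\beta)}^\top[\boldsymbol L^{cc}]^{-1}\boldsymbol e_{(\alpha,\beta)}\big]^2}$$ if it connects two passive nodes (here $\boldsymbol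 e_{(\alpha,\beta)}\in\mathbb R^{|\mathcal N_c|}$); and $$\mathcal P_{\boldsymbol\varphi}=\frac{P_{\alpha,\beta}^2\tau^2}{2d}\;\frac{\Omega_{\alpha\beta}-[\boldsymbol L^{cc}]^{-1}_{\beta\beta}}{\big[1-b_{\alpha\beta}[\boldsymbol L^{cc}]^{-1}_{\beta\beta}\big]^2}$$ if it connects a synchronous machine $\alpha$ and a passive node $\beta$. Here $P_{\alpha,\beta}=b_{\alpha\beta}(\theta^\star_\alpha-\theta^\star_\beta)$ is the power flow on the line prior to the fault and $\Omega_{\alpha\beta}=\boldsymbol e_{(\alpha,\beta)}^\top(\boldsymbol L^{\rm ph})^\dagger\boldsymbol e_{(\alpha,\beta)}$ is the resistance distance in the physical network prior to Kron reduction, $\dagger$ denoting the Moore–Penrose pseudoinverse. -/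

import Mathlib

open MeasureTheory Filter Topology Matrix

noncomputable section

namespace KronSwing

/-- An undirected weighted network on the buses `V`: `b i j > 0` is the susceptance of the line
between `i` and `j`, and `b i j = 0` means that there is no such line. -/
structure PowerNetwork (V : Type*) where
  /-- line susceptances -/
  b : V → V → ℝ
  symm : ∀ i j, b i j = b j i
  nonneg : ∀ i j, 0 ≤ b i j
  diag_zero : ∀ i, b i i = 0

/-- The vector `e_(i,j) = e_i - e_j`. -/
def edgeVec {V : Type*} [DecidableEq V] (i j : V) : V → ℝ :=
  Pi.single i 1 - Pi.single j 1

/-- The Moore-Penrose pseudoinverse `T diag(λ⁻¹) Tᵀ` of a real symmetric matrix `T diag(λ) Tᵀ`,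
where zero eigenvalues are kept equal to zero (in Lean `(0 : ℝ)⁻¹ = 0`). -/
def symPinv {V : Type*} [Fintype V] [DecidableEq V] {A : Matrix V V ℝ} (hA : A.IsHermitian) :
    Matrix V V ℝ :=
  (hA.eigenvectorUnitary : Matrix V V ℝ) * Matrix.diagonal (fun i => (hA.eigenvalues i)⁻¹) *
    (hA.eigenvectorUnitary : Matrix V V ℝ)ᵀ

namespace PowerNetwork

section General

variable {V : Type*} (N : PowerNetwork V)

/-- The graph of the lines of the network. -/
def graph : SimpleGraph V where
  Adj i j := 0 < N.b i j
  symm := ⟨fun i j h => by rw [N.symm j i]; exact h⟩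
  loopless := ⟨fun i h => by rw [N.diag_zero i] at h; exact lt_irrefl _ h⟩

variable [Fintype V] [DecidableEq V]

/-- The Laplacian matrix of the network. -/
def laplacian : Matrix V V ℝ :=
  Matrix.diagonal (fun i => ∑ j, N.b i j) - Matrix.of N.b

theorem laplacian_isHermitian : N.laplacian.IsHermitian := by
  refine Matrix.IsHermitian.ext fun i j => ?_
  by_cases h : i = j
  · subst h
    simp
  · simp [laplacian, Matrix.diagonal_apply_ne _ h, Matrix.diagonal_apply_ne' _ h, N.symm i j]

/-- The resistance distance `Ω_ij = e_(i,j)ᵀ L† e_(i,j)`. -/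
def resistanceDistance (i j : V) : ℝ :=
  edgeVec i j ⬝ᵥ (symPinv N.laplacian_isHermitian *ᵥ edgeVec i j)

/-- The Laplacian of the network without the line between `i` and `j`,
`L - b_ij e_(i,j) e_(i,j)ᵀ`. -/
def faultedLaplacian (i j : V) : Matrix V V ℝ :=
  N.laplacian - N.b i j • Matrix.vecMulVec (edgeVec i j) (edgeVec i j)

/-- `i` and `j` are joined by a line, and its removal does not split the network. -/
def IsNonsplittingLine (i j : V) : Prop :=
  N.graph.Adj i j ∧ (N.graph.deleteEdges {s(i, j)}).Connected

/-- The power flowing from `i` to `j` when the voltage angles are `θ`. -/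
def lineFlow (θ : V → ℝ) (i j : V) : ℝ := N.b i j * (θ i - θ j)

end General

end PowerNetwork

section Kron

variable {G C : Type*} [Fintype G] [Fintype C] [DecidableEq G] [DecidableEq C]

/-- Kron-reduced matrix `A^gg - A^gc (A^cc)⁻¹ A^cg`: the passive buses `C` are eliminated. -/
def kronMatrix (A : Matrix (G ⊕ C) (G ⊕ C) ℝ) : Matrix G G ℝ :=
  A.toBlocks₁₁ - A.toBlocks₁₂ * A.toBlocks₂₂⁻¹ * A.toBlocks₂₁

/-- Kron-reduced injections `P_g - A^gc (A^cc)⁻¹ P_c`. -/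
def kronInjection (A : Matrix (G ⊕ C) (G ⊕ C) ℝ) (P : G ⊕ C → ℝ) : G → ℝ :=
  (fun i => P (Sum.inl i)) - (A.toBlocks₁₂ * A.toBlocks₂₂⁻¹) *ᵥ (fun k => P (Sum.inr k))

/-- `φ` and `ω` are the angle and frequency deviations, relative to the operating point `θ`, of
the Kron-reduced swing dynamics with regularized Laplacian `L_red + ε I`, inertias `m` and
dampings `d`, after a Dirac-δ fault of strength `τ` of the line between `i` and `j`.
During the fault the Kron-reduced data `P_red`, `L_red` of the network are replaced by those
of the network without the line, i.e. `P_red(t) = P_red + τ δ(t) (P_red' - P_red)` and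
`L_red(t) = L_red + τ δ(t) (L_red' - L_red)`, so that
`M φ'' = -D φ' - (L_red + ε I) φ + τ δ(t) ((P_red' - P_red) - (L_red' - L_red) (θ_g + φ))`.
The system is at rest before the fault, and the equation is written in integrated form,
with `δ` the Dirac measure at time `0`. -/
structure IsFaultResponse (N : PowerNetwork (G ⊕ C)) (P θ : G ⊕ C → ℝ) (m d : G → ℝ) (τ : ℝ)
    (i j : G ⊕ C) (ε : ℝ) (φ ω : ℝ → G → ℝ) : Prop where
  angle_before : ∀ t < 0, φ t = 0
  freq_before : ∀ t < 0, ω t = 0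
  locallyIntegrable : LocallyIntegrable ω
  angle_eq : ∀ t, 0 ≤ t → φ t = ∫ s in (0 : ℝ)..t, ω s
  freq_eq : ∀ t, 0 ≤ t →
    Matrix.diagonal m *ᵥ ω t =
      (∫ s in (0 : ℝ)..t,
        (-(Matrix.diagonal d *ᵥ ω s)
          - (kronMatrix N.laplacian + ε • (1 : Matrix G G ℝ)) *ᵥ φ s)) +
      ∫ s in Set.Icc (0 : ℝ) t,
        τ • ((kronInjection (N.faultedLaplacian i j) P - kronInjection N.laplacian P)
          - (kronMatrix (N.faultedLaplacian i j) - kronMatrix N.laplacian) *ᵥ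
              ((fun k => θ (Sum.inl k)) + φ s)) ∂(Measure.dirac (0 : ℝ))

/-- The angle coherence measure `∫₀^∞ φᵀ φ dt`. -/
def angleCoherence (φ : ℝ → G → ℝ) : ℝ := ∫ t in Set.Ioi (0 : ℝ), φ t ⬝ᵥ φ t

/-- The angle coherence measure of the fault of the line between `i` and `j` has the regularized
value `v`: for every `ε > 0` the response to the fault exists, is unique, and has an integrable
`φᵀ φ`, and the angle coherence of the response tends to `v` as `ε → 0`, `ε > 0`. -/
def HasAngleCoherence (N : PowerNetwork (G ⊕ C)) (P θ : G ⊕ C → ℝ) (m d : G → ℝ) (τ : ℝ)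
    (i j : G ⊕ C) (v : ℝ) : Prop :=
  (∀ ε : ℝ, 0 < ε → ∃! x : (ℝ → G → ℝ) × (ℝ → G → ℝ),
    IsFaultResponse N P θ m d τ i j ε x.1 x.2) ∧
  ∀ φ ω : ℝ → ℝ → G → ℝ,
    (∀ ε : ℝ, 0 < ε → IsFaultResponse N P θ m d τ i j ε (φ ε) (ω ε)) →
      (∀ ε : ℝ, 0 < ε → IntegrableOn (fun t => φ ε t ⬝ᵥ φ ε t) (Set.Ioi 0)) ∧
      Tendsto (fun ε => angleCoherence (φ ε)) (𝓝[>] 0) (𝓝 v)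

/-- The passive blocks `L^cc` before and during the fault are invertible, that is, the Kron
reductions before and during the fault exist. -/
def KronReducible (N : PowerNetwork (G ⊕ C)) (i j : G ⊕ C) : Prop :=
  IsUnit N.laplacian.toBlocks₂₂.det ∧ IsUnit (N.faultedLaplacian i j).toBlocks₂₂.det

end Kron

end KronSwing

end

/-! Write `e` for the edge vector of the faulted line, `b` for its susceptance, and `r` for the form
e_cᵀ (L^cc)⁻¹ e_c of its passive part. All three cases are one formula in `r`.

The fault is a rank one update, and P = Lθ = L'θ + (line flow) e. Kron reduction sends Lθ to L_red
θ_g and L'θ to L_red' θ_g, so only the reduced injection of `e` survives in the impulse. By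
Sherman-Morrison (`kronInjection_rankOne`) passing from L' to L costs the factor 1/(1 - b r), whose
square is the denominator. With Y = L† e one has L Y = e, so the reduced injection of `e` is L_red
Y_g, and block elimination gives Y_gᵀ L_red Y_g = Ω - r (`exists_kronMatrix_mulVec_eq`).

On the dynamical side the angles are continuous, so φ vanishes when the impulse J acts. The response
is the free swing motion with φ(0) = 0 and mω(0) = J. A quadratic Lyapunov function with derivative
-φᵀφ gives the integral Jᵀ (L_red + ε)⁻¹ J / (2d) (`integral_dotProduct_self_of_swing`). Although
L_red is singular, J = L_red (c y) lies in its range, so the limit ε → 0 is finite and equals c² yᵀ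
L_red y / (2d). -/

noncomputable section

set_option linter.unusedSectionVars false

namespace KronSwing

/-! ### Pseudoinverse of a symmetric matrix -/

section Linear

variable {V : Type*} [Fintype V] [DecidableEq V]

theorem edgeVec_dotProduct (i j : V) (x : V → ℝ) : edgeVec i j ⬝ᵥ x = x i - x j := by
  simp [edgeVec, sub_dotProduct]

/-- A vector orthogonal to the kernel of a symmetric matrix is reproduced by `A A†`. -/
theorem mulVec_symPinv_mulVec {A : Matrix V V ℝ} (hA : A.IsHermitian) (e : V → ℝ)
    (he : ∀ x, A *ᵥ x = 0 → e ⬝ᵥ x = 0) : A *ᵥ (symPinv hA *ᵥ e) = e := by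
  set U : Matrix V V ℝ := (hA.eigenvectorUnitary : Matrix V V ℝ) with hU
  have hUU : U * Uᵀ = 1 := by
    have := Unitary.coe_mul_star_self hA.eigenvectorUnitary
    rwa [Unitary.coe_star, star_eq_conjTranspose, conjTranspose_eq_transpose_of_trivial] at this
  have hUU' : Uᵀ * U = 1 := mul_eq_one_comm.mp hUU
  have hs : A = U * diagonal hA.eigenvalues * Uᵀ := by
    have := hA.spectral_theorem
    rw [Unitary.conjStarAlgAut_apply, star_eq_conjTranspose,
      conjTranspose_eq_transpose_of_trivial] at this
    simpa using this
  have hAU : A * U = U * diagonal hA.eigenvalues := by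
    conv_lhs => rw [hs]
    rw [Matrix.mul_assoc, hUU', Matrix.mul_one]
  -- Orthogonality to the kernel kills the components along zero eigenvalues, exactly where the
  -- convention 0⁻¹ = 0 would otherwise lose them.
  have hz : ∀ i, hA.eigenvalues i = 0 → (Uᵀ *ᵥ e) i = 0 := by
    intro i hi
    have h1 : A *ᵥ (U *ᵥ Pi.single i 1) = 0 := by
      rw [mulVec_mulVec, hAU, ← mulVec_mulVec]
      have : diagonal hA.eigenvalues *ᵥ Pi.single i (1 : ℝ) = 0 := by
        ext k
        by_cases hk : k = i
        · subst hk; simp [mulVec_diagonal, hi]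
        · simp [mulVec_diagonal, hk]
      rw [this, mulVec_zero]
    have h2 := he _ h1
    rw [dotProduct_mulVec, dotProduct_single, mul_one] at h2
    rw [mulVec_transpose, h2]
  have hd : diagonal hA.eigenvalues *ᵥ (diagonal (fun i => (hA.eigenvalues i)⁻¹) *ᵥ (Uᵀ *ᵥ e))
      = Uᵀ *ᵥ e := by
    ext i
    rw [mulVec_diagonal, mulVec_diagonal]
    by_cases hi : hA.eigenvalues i = 0
    · rw [hz i hi]; simp
    · field_simp
  have : symPinv hA *ᵥ e
      = U *ᵥ (diagonal (fun i => (hA.eigenvalues i)⁻¹) *ᵥ (Uᵀ *ᵥ e)) := by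
    simp [symPinv, ← hU, mulVec_mulVec, Matrix.mul_assoc]
  rw [this, mulVec_mulVec, hAU, ← mulVec_mulVec, hd, mulVec_mulVec, hUU, one_mulVec]

end Linear

/-! ### Laplacians, connectivity and line removal -/

namespace PowerNetwork

section General

variable {V : Type*} [Fintype V] [DecidableEq V] (N : PowerNetwork V)

theorem laplacian_mulVec_apply (x : V → ℝ) (i : V) :
    (N.laplacian *ᵥ x) i = ∑ j, N.b i j * (x i - x j) := by
  rw [laplacian, sub_mulVec, Pi.sub_apply, mulVec_diagonal, Finset.sum_mul]
  simp only [mul_sub, Finset.sum_sub_distrib]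
  rfl

theorem two_mul_dotProduct_laplacian_mulVec (x : V → ℝ) :
    2 * (x ⬝ᵥ (N.laplacian *ᵥ x)) = ∑ i, ∑ j, N.b i j * (x i - x j) ^ 2 := by
  have h : x ⬝ᵥ (N.laplacian *ᵥ x) = ∑ i, ∑ j, x i * (N.b i j * (x i - x j)) := by
    simp only [dotProduct, laplacian_mulVec_apply, Finset.mul_sum]
  have h' : x ⬝ᵥ (N.laplacian *ᵥ x) = ∑ i, ∑ j, x j * (N.b i j * (x j - x i)) := by
    rw [h, Finset.sum_comm]
    exact Finset.sum_congr rfl fun i _ => Finset.sum_congr rfl fun j _ => by rw [N.symm]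
  rw [two_mul]
  nth_rw 1 [h]
  rw [h']
  simp only [← Finset.sum_add_distrib]
  exact Finset.sum_congr rfl fun i _ => Finset.sum_congr rfl fun j _ => by ring

theorem laplacian_posSemidef : N.laplacian.PosSemidef := by
  refine PosSemidef.of_dotProduct_mulVec_nonneg N.laplacian_isHermitian fun x => ?_
  have h := N.two_mul_dotProduct_laplacian_mulVec x
  have : 0 ≤ ∑ i, ∑ j, N.b i j * (x i - x j) ^ 2 :=
    Finset.sum_nonneg fun i _ => Finset.sum_nonneg fun j _ =>
      mul_nonneg (N.nonneg i j) (sq_nonneg _)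
  simp only [star_trivial]
  linarith

/-- On a connected network, only constant vectors annihilate the Laplacian form. -/
theorem eq_of_dotProduct_laplacian_mulVec_eq_zero (hN : N.graph.Connected) {x : V → ℝ}
    (hx : x ⬝ᵥ (N.laplacian *ᵥ x) = 0) (i j : V) : x i = x j := by
  have h := N.two_mul_dotProduct_laplacian_mulVec x
  rw [hx, mul_zero] at h
  have hnn : ∀ i j, 0 ≤ N.b i j * (x i - x j) ^ 2 := fun i j =>
    mul_nonneg (N.nonneg i j) (sq_nonneg _)
  have hadj : ∀ i j, N.graph.Adj i j → x i = x j := by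
    intro i j hij
    have h1 := (Finset.sum_eq_zero_iff_of_nonneg
      (fun i _ => Finset.sum_nonneg fun j _ => hnn i j)).mp h.symm i (Finset.mem_univ i)
    have h2 := (Finset.sum_eq_zero_iff_of_nonneg (fun j _ => hnn i j)).mp h1 j (Finset.mem_univ j)
    have hb : 0 < N.b i j := hij
    rcases mul_eq_zero.mp h2 with h3 | h3
    · exact absurd h3 hb.ne'
    · exact sub_eq_zero.mp (pow_eq_zero_iff (two_ne_zero) |>.mp h3)
  obtain ⟨p⟩ := hN.preconnected i j
  induction p with
  | nil => rfl
  | cons hij _ ih => exact (hadj _ _ hij).trans ih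

/-- The network without the line between `i` and `j`. -/
def deleteLine (i j : V) : PowerNetwork V where
  b k l := if s(k, l) = s(i, j) then 0 else N.b k l
  symm k l := by rw [Sym2.eq_swap (a := k), N.symm]
  nonneg k l := by split_ifs; exacts [le_rfl, N.nonneg k l]
  diag_zero k := by simp [N.diag_zero]

theorem deleteLine_connected {i j : V} (h : N.IsNonsplittingLine i j) :
    (N.deleteLine i j).graph.Connected := by
  refine h.2.mono fun k l hkl => ?_
  rw [SimpleGraph.deleteEdges_adj] at hkl
  have hne : s(k, l) ≠ s(i, j) := hkl.2
  have : 0 < N.b k l := hkl.1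
  change 0 < if s(k, l) = s(i, j) then 0 else N.b k l
  rwa [if_neg hne]

theorem connected_of_isNonsplittingLine {i j : V} (h : N.IsNonsplittingLine i j) :
    N.graph.Connected :=
  h.2.mono (SimpleGraph.deleteEdges_le _)

/-- Makes the rank one update the Laplacian of an actual network, so that the positivity results for
connected networks also apply during the fault. -/
theorem laplacian_deleteLine {i j : V} (hij : i ≠ j) :
    (N.deleteLine i j).laplacian = N.faultedLaplacian i j := by
  have hb : ∀ k l, (N.deleteLine i j).b k l = N.b k l -
      N.b i j * ((if k = i then 1 else 0) * (if l = j then 1 else 0)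
        + (if k = j then 1 else 0) * (if l = i then 1 else 0)) := by
    intro k l
    simp only [deleteLine, Sym2.eq_iff]
    by_cases h1 : k = i <;> by_cases h2 : l = j <;> by_cases h3 : k = j <;> by_cases h4 : l = i <;>
      simp_all [N.symm i j]
  have hx : ∀ x : V → ℝ, (N.deleteLine i j).laplacian *ᵥ x = N.faultedLaplacian i j *ᵥ x := by
    intro x
    ext k
    rw [laplacian_mulVec_apply, faultedLaplacian, sub_mulVec, Pi.sub_apply,
      laplacian_mulVec_apply, smul_mulVec, vecMulVec_mulVec, edgeVec_dotProduct]
    have h1 : ∀ l, (N.deleteLine i j).b k l * (x k - x l) = N.b k l * (x k - x l)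
        - N.b i j * ((if k = i then 1 else 0) * (if l = j then (x k - x l) else 0)
        + (if k = j then 1 else 0) * (if l = i then (x k - x l) else 0)) := by
      intro l
      rw [hb]
      split_ifs <;> ring
    simp only [h1, Finset.sum_sub_distrib, ← Finset.mul_sum, Finset.sum_add_distrib]
    simp only [Finset.sum_ite_eq', Finset.mem_univ, if_true]
    congr 1
    by_cases h2 : k = i
    · subst h2; simp [edgeVec, hij]
    · by_cases h3 : k = j
      · subst h3; simp [edgeVec, h2]
      · simp [edgeVec, h2, h3]
  exact Matrix.ext_of_mulVec_single fun l => hx _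

/-- On a connected network the kernel consists of constant vectors, to which an edge vector is
orthogonal. -/
theorem laplacian_mulVec_symPinv_edgeVec (hN : N.graph.Connected) (i j : V) :
    N.laplacian *ᵥ (symPinv N.laplacian_isHermitian *ᵥ edgeVec i j) = edgeVec i j := by
  refine mulVec_symPinv_mulVec _ _ fun x hx => ?_
  rw [edgeVec_dotProduct, sub_eq_zero]
  exact N.eq_of_dotProduct_laplacian_mulVec_eq_zero hN (by rw [hx, dotProduct_zero]) i j

end General

/-! ### Positivity of the passive block and of the Kron reduction -/

section Blocks

variable {G C : Type*} [Fintype G] [Fintype C] [DecidableEq G] [DecidableEq C]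
  (N : PowerNetwork (G ⊕ C))

theorem laplacian_eq_fromBlocks : N.laplacian = fromBlocks N.laplacian.toBlocks₁₁
    N.laplacian.toBlocks₁₂ N.laplacian.toBlocks₁₂ᴴ N.laplacian.toBlocks₂₂ := by
  have h := N.laplacian_isHermitian
  rw [← fromBlocks_toBlocks N.laplacian, isHermitian_fromBlocks_iff] at h
  conv_lhs => rw [← fromBlocks_toBlocks N.laplacian]
  rw [h.2.1]

/-- Extend a passive vector by zero on the machines. If its form vanishes, the extension is
constant, and any single machine forces that constant to be zero. -/
theorem passiveBlock_posDef [Nonempty G] (hN : N.graph.Connected) :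
    N.laplacian.toBlocks₂₂.PosDef := by
  have hs : N.laplacian.toBlocks₂₂.PosSemidef := N.laplacian_posSemidef.submatrix Sum.inr
  refine PosDef.of_dotProduct_mulVec_pos hs.1 fun x hx => ?_
  refine lt_of_le_of_ne (hs.dotProduct_mulVec_nonneg x) fun h0 => hx ?_
  simp only [star_trivial] at h0
  have h1 : Sum.elim (0 : G → ℝ) x ⬝ᵥ (N.laplacian *ᵥ Sum.elim (0 : G → ℝ) x) = 0 := by
    rw [← fromBlocks_toBlocks N.laplacian, fromBlocks_mulVec]
    simpa [Sum.elim_comp_inl, Sum.elim_comp_inr] using h0.symm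
  ext k
  obtain ⟨g⟩ := ‹Nonempty G›
  exact N.eq_of_dotProduct_laplacian_mulVec_eq_zero hN h1 (Sum.inr k) (Sum.inl g)

/-- The Kron reduction is the Schur complement of the positive definite passive block. -/
theorem kronMatrix_laplacian_posSemidef [Nonempty G] (hN : N.graph.Connected) :
    (kronMatrix N.laplacian).PosSemidef := by
  have hD := N.passiveBlock_posDef hN
  have : Invertible N.laplacian.toBlocks₂₂ := hD.isUnit.invertible
  have h := N.laplacian_posSemidef
  rw [N.laplacian_eq_fromBlocks, hD.fromBlocks₂₂] at h
  have h2 : N.laplacian.toBlocks₂₁ = N.laplacian.toBlocks₁₂ᴴ := by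
    conv_lhs => rw [N.laplacian_eq_fromBlocks]
    simp
  rwa [kronMatrix, h2]

end Blocks

end PowerNetwork

/-! ### Kron reduction, rank one updates and the regularized limit -/

section Kron

variable {G C : Type*} [Fintype G] [Fintype C] [DecidableEq G] [DecidableEq C]

/-- Kron reduction maps the injections `A θ` to `A_red θ_g`. -/
theorem kronInjection_mulVec (A : Matrix (G ⊕ C) (G ⊕ C) ℝ) (hA : IsUnit A.toBlocks₂₂.det)
    (θ : G ⊕ C → ℝ) :
    kronInjection A (A *ᵥ θ) = kronMatrix A *ᵥ fun k => θ (Sum.inl k) := by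
  have h : A *ᵥ θ = Sum.elim
      (A.toBlocks₁₁ *ᵥ (θ ∘ Sum.inl) + A.toBlocks₁₂ *ᵥ (θ ∘ Sum.inr))
      (A.toBlocks₂₁ *ᵥ (θ ∘ Sum.inl) + A.toBlocks₂₂ *ᵥ (θ ∘ Sum.inr)) := by
    conv_lhs => rw [← fromBlocks_toBlocks A]
    rw [fromBlocks_mulVec]
  rw [h]
  simp only [kronInjection, kronMatrix, Sum.elim_inl, Sum.elim_inr]
  change (A.toBlocks₁₁ *ᵥ (θ ∘ Sum.inl) + A.toBlocks₁₂ *ᵥ (θ ∘ Sum.inr)) -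
    (A.toBlocks₁₂ * A.toBlocks₂₂⁻¹) *ᵥ
      (A.toBlocks₂₁ *ᵥ (θ ∘ Sum.inl) + A.toBlocks₂₂ *ᵥ (θ ∘ Sum.inr)) = _ *ᵥ (θ ∘ Sum.inl)
  rw [mulVec_add, mulVec_mulVec, mulVec_mulVec, Matrix.mul_assoc _ _ A.toBlocks₂₂,
    nonsing_inv_mul _ hA, Matrix.mul_one, sub_mulVec]
  abel

theorem kronInjection_add_smul (A : Matrix (G ⊕ C) (G ⊕ C) ℝ) (P Q : G ⊕ C → ℝ) (c : ℝ) :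
    kronInjection A (P + c • Q) = kronInjection A P + c • kronInjection A Q := by
  have : (fun k => (P + c • Q) (Sum.inr k)) =
      (fun k => P (Sum.inr k)) + c • fun k => Q (Sum.inr k) := rfl
  simp only [kronInjection, this, mulVec_add, mulVec_smul]
  ext k
  simp
  ring

/-- The quadratic form `e_cᵀ (A^cc)⁻¹ e_c` of the passive part of `e`. -/
def passiveForm (A : Matrix (G ⊕ C) (G ⊕ C) ℝ) (e : G ⊕ C → ℝ) : ℝ :=
  (fun k => e (Sum.inr k)) ⬝ᵥ (A.toBlocks₂₂⁻¹ *ᵥ fun k => e (Sum.inr k))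

section RankOne

variable (A : Matrix (G ⊕ C) (G ⊕ C) ℝ) (e : G ⊕ C → ℝ) (b : ℝ)

/-- Source of the denominator 1 - b r: on (A^cc)⁻¹ e_c the update acts by rescaling the image `e_c`.
-/
theorem toBlocks₂₂_rankOne_mulVec (hA : IsUnit A.toBlocks₂₂.det) :
    (A - b • vecMulVec e e).toBlocks₂₂ *ᵥ (A.toBlocks₂₂⁻¹ *ᵥ fun k => e (Sum.inr k)) =
      (1 - b * passiveForm A e) • fun k => e (Sum.inr k) := by
  have h : (A - b • vecMulVec e e).toBlocks₂₂ = A.toBlocks₂₂ -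
      b • vecMulVec (fun k => e (Sum.inr k)) (fun k => e (Sum.inr k)) := rfl
  rw [h, sub_mulVec, mulVec_mulVec, mul_nonsing_inv _ hA, one_mulVec, smul_mulVec,
    vecMulVec_mulVec]
  ext k
  simp [passiveForm]
  ring

/-- If the factor vanished, the invertible updated block would annihilate (A^cc)⁻¹ e_c. That vector
would be zero, making r = 0 and the factor 1. -/
theorem one_sub_mul_passiveForm_ne_zero (hA : IsUnit A.toBlocks₂₂.det)
    (hB : IsUnit (A - b • vecMulVec e e).toBlocks₂₂.det) : 1 - b * passiveForm A e ≠ 0 := by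
  intro h0
  have h := toBlocks₂₂_rankOne_mulVec A e b hA
  rw [h0, zero_smul] at h
  have hu : A.toBlocks₂₂⁻¹ *ᵥ (fun k => e (Sum.inr k)) = 0 := by
    rw [← one_mulVec (A.toBlocks₂₂⁻¹ *ᵥ _), ← nonsing_inv_mul _ hB, ← mulVec_mulVec, h,
      mulVec_zero]
  rw [passiveForm, hu] at h0
  simp at h0

/-- Sherman-Morrison for the Kron-reduced injection of the vector of a rank one update. -/
theorem kronInjection_rankOne (hA : IsUnit A.toBlocks₂₂.det)
    (hB : IsUnit (A - b • vecMulVec e e).toBlocks₂₂.det) :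
    kronInjection (A - b • vecMulVec e e) e = (1 - b * passiveForm A e)⁻¹ • kronInjection A e := by
  have hr := one_sub_mul_passiveForm_ne_zero A e b hA hB
  have h := toBlocks₂₂_rankOne_mulVec A e b hA
  set r := passiveForm A e with hrdef
  set u := A.toBlocks₂₂⁻¹ *ᵥ (fun k => e (Sum.inr k)) with hu
  have hi : (A - b • vecMulVec e e).toBlocks₂₂⁻¹ *ᵥ (fun k => e (Sum.inr k))
      = (1 - b * r)⁻¹ • u := by
    have : (fun k => e (Sum.inr k)) = (A - b • vecMulVec e e).toBlocks₂₂ *ᵥ ((1 - b * r)⁻¹ • u) := by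
      rw [mulVec_smul, h, smul_smul, inv_mul_cancel₀ hr, one_smul]
    conv_lhs => rw [this]
    rw [mulVec_mulVec, nonsing_inv_mul _ hB, one_mulVec]
  have h12 : (A - b • vecMulVec e e).toBlocks₁₂ = A.toBlocks₁₂ -
      b • vecMulVec (fun k => e (Sum.inl k)) (fun k => e (Sum.inr k)) := rfl
  have hru : (fun k => e (Sum.inr k)) ⬝ᵥ u = r := rfl
  simp only [kronInjection]
  rw [← mulVec_mulVec, hi, ← mulVec_mulVec, ← hu, h12, mulVec_smul, sub_mulVec, smul_mulVec,
    vecMulVec_mulVec, hru]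
  ext k
  simp
  field_simp
  ring

end RankOne

/-- The Dirac impulse received by the Kron-reduced network is proportional to the Kron-reduced
injection of `e_(i,j)`. -/
theorem kronInjection_faulted_sub (N : PowerNetwork (G ⊕ C)) (θ : G ⊕ C → ℝ) {i j : G ⊕ C}
    (h : KronReducible N i j) :
    (kronInjection (N.faultedLaplacian i j) (N.laplacian *ᵥ θ)
        - kronInjection N.laplacian (N.laplacian *ᵥ θ))
      - (kronMatrix (N.faultedLaplacian i j) - kronMatrix N.laplacian) *ᵥ
          (fun k => θ (Sum.inl k)) =
    (N.lineFlow θ i j * (1 - N.b i j * passiveForm N.laplacian (edgeVec i j))⁻¹) •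
      kronInjection N.laplacian (edgeVec i j) := by
  -- The injections that balance the intact network exceed those balancing the faulted one by the
  -- flow of the lost line.
  have hP : N.laplacian *ᵥ θ = N.faultedLaplacian i j *ᵥ θ + N.lineFlow θ i j • edgeVec i j := by
    rw [PowerNetwork.faultedLaplacian, sub_mulVec, smul_mulVec, vecMulVec_mulVec,
      edgeVec_dotProduct]
    ext k
    simp [PowerNetwork.lineFlow]
    ring
  rw [kronInjection_mulVec N.laplacian h.1, hP, kronInjection_add_smul,
    kronInjection_mulVec _ h.2]
  have hk := kronInjection_rankOne N.laplacian (edgeVec i j) (N.b i j) h.1 h.2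
  rw [mul_smul, ← hk, sub_mulVec]
  change _ + N.lineFlow θ i j • kronInjection (N.faultedLaplacian i j) (edgeVec i j) - _ - _ =
    N.lineFlow θ i j • kronInjection (N.faultedLaplacian i j) (edgeVec i j)
  abel

theorem exists_kronMatrix_mulVec_eq (N : PowerNetwork (G ⊕ C)) (hN : N.graph.Connected)
    (hc : IsUnit N.laplacian.toBlocks₂₂.det) (i j : G ⊕ C) :
    ∃ y, kronMatrix N.laplacian *ᵥ y = kronInjection N.laplacian (edgeVec i j) ∧
      y ⬝ᵥ (kronMatrix N.laplacian *ᵥ y) =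
        N.resistanceDistance i j - passiveForm N.laplacian (edgeVec i j) := by
  set Y := symPinv N.laplacian_isHermitian *ᵥ edgeVec i j with hY
  have hLY : N.laplacian *ᵥ Y = edgeVec i j := N.laplacian_mulVec_symPinv_edgeVec hN i j
  have hk : kronMatrix N.laplacian *ᵥ (fun k => Y (Sum.inl k))
      = kronInjection N.laplacian (edgeVec i j) := by
    rw [← hLY, kronInjection_mulVec _ hc]
  refine ⟨fun k => Y (Sum.inl k), hk, ?_⟩
  rw [hk]
  set e := edgeVec i j with he
  set ec : C → ℝ := fun k => e (Sum.inr k) with hec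
  set yg : G → ℝ := fun k => Y (Sum.inl k) with hyg
  set yc : C → ℝ := fun k => Y (Sum.inr k) with hyc
  have hΩ : N.resistanceDistance i j = (fun k => e (Sum.inl k)) ⬝ᵥ yg + ec ⬝ᵥ yc := by
    change e ⬝ᵥ Y = _
    simp [dotProduct, Fintype.sum_sum_type, hec, hyg, hyc]
  have h2 : N.laplacian.toBlocks₂₁ *ᵥ yg + N.laplacian.toBlocks₂₂ *ᵥ yc = ec := by
    have := hLY
    rw [← fromBlocks_toBlocks N.laplacian, fromBlocks_mulVec] at this
    ext k
    exact congrFun this (Sum.inr k)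
  have h21 : N.laplacian.toBlocks₂₁ = N.laplacian.toBlocks₁₂ᵀ := by
    conv_lhs => rw [N.laplacian_eq_fromBlocks]
    simp
  have h22 : N.laplacian.toBlocks₂₂ᵀ = N.laplacian.toBlocks₂₂ := by
    have := N.laplacian_isHermitian
    ext k l
    exact congrFun (congrFun this (Sum.inr k)) (Sum.inr l)
  set u := N.laplacian.toBlocks₂₂⁻¹ *ᵥ ec with hu
  have hLu : N.laplacian.toBlocks₂₂ *ᵥ u = ec := by
    rw [hu, mulVec_mulVec, mul_nonsing_inv _ hc, one_mulVec]
  -- Substitute the passive rows of L Y = e into e_cᵀ u and move the blocks across by symmetry. The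
  -- term e_cᵀ y_c then cancels in Ω - r.
  have h3 : passiveForm N.laplacian e = yg ⬝ᵥ (N.laplacian.toBlocks₁₂ *ᵥ u) + ec ⬝ᵥ yc := by
    change ec ⬝ᵥ u = _
    nth_rw 1 [← h2]
    rw [add_dotProduct, h21, mulVec_transpose, ← dotProduct_mulVec]
    congr 1
    nth_rw 1 [← h22]
    rw [mulVec_transpose, ← dotProduct_mulVec, hLu, dotProduct_comm]
  rw [hΩ, h3, kronInjection, ← mulVec_mulVec, dotProduct_sub, dotProduct_comm yg]
  ring

/-- `(L y)ᵀ (L + ε)⁻¹ (L y) → yᵀ L y` for positive semidefinite `L`. -/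
theorem tendsto_dotProduct_inv_add_smul {L : Matrix G G ℝ} (hL : L.PosSemidef) (y : G → ℝ) :
    Tendsto (fun ε : ℝ => (L *ᵥ y) ⬝ᵥ ((L + ε • (1 : Matrix G G ℝ))⁻¹ *ᵥ (L *ᵥ y))) (𝓝[>] 0)
      (𝓝 (y ⬝ᵥ (L *ᵥ y))) := by
  have hLt : Lᵀ = L := by
    rw [← conjTranspose_eq_transpose_of_trivial]; exact hL.1
  have hsymm : ∀ a c : G → ℝ, (L *ᵥ a) ⬝ᵥ c = a ⬝ᵥ (L *ᵥ c) := by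
    intro a c
    nth_rw 1 [← hLt]
    rw [mulVec_transpose, ← dotProduct_mulVec]
  -- With z = (L + ε)⁻¹ y, the error is -ε (yᵀy - ε yᵀz), and the bracket equals |Lz|² + ε zᵀLz,
  -- which lies between 0 and yᵀy.
  have key : ∀ ε : ℝ, 0 < ε →
      |(L *ᵥ y) ⬝ᵥ ((L + ε • (1 : Matrix G G ℝ))⁻¹ *ᵥ (L *ᵥ y)) - y ⬝ᵥ (L *ᵥ y)|
        ≤ ε * (y ⬝ᵥ y) := by
    intro ε hε
    have hK : (L + ε • (1 : Matrix G G ℝ)).PosDef :=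
      PosDef.posSemidef_add hL (PosDef.one.smul hε)
    have hKu : IsUnit (L + ε • (1 : Matrix G G ℝ)).det :=
      (isUnit_iff_isUnit_det _).mp hK.isUnit
    set z := (L + ε • (1 : Matrix G G ℝ))⁻¹ *ᵥ y with hz
    have hy : L *ᵥ z + ε • z = y := by
      have : (L + ε • (1 : Matrix G G ℝ)) *ᵥ z = y := by
        rw [hz, mulVec_mulVec, mul_nonsing_inv _ hKu, one_mulVec]
      rwa [add_mulVec, smul_mulVec, one_mulVec] at this
    have hLy : (L + ε • (1 : Matrix G G ℝ))⁻¹ *ᵥ (L *ᵥ y) = L *ᵥ z := by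
      have : L *ᵥ y = (L + ε • (1 : Matrix G G ℝ)) *ᵥ (L *ᵥ z) := by
        rw [add_mulVec, smul_mulVec, one_mulVec]
        nth_rw 1 [← hy]
        rw [mulVec_add, mulVec_smul]
      rw [this, mulVec_mulVec, nonsing_inv_mul _ hKu, one_mulVec]
    have hLz : L *ᵥ z = y - ε • z := eq_sub_of_add_eq hy
    have hn : 0 ≤ z ⬝ᵥ (L *ᵥ z) := hL.dotProduct_mulVec_nonneg z
    have hzz : 0 ≤ z ⬝ᵥ z := by simpa using dotProduct_star_self_nonneg z
    have hLL : 0 ≤ (L *ᵥ z) ⬝ᵥ (L *ᵥ z) := by simpa using dotProduct_star_self_nonneg (L *ᵥ z)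
    rw [hLy, hLz, dotProduct_sub, hsymm y y, hsymm y (ε • z), mulVec_smul, hLz]
    have hyz : y ⬝ᵥ z = z ⬝ᵥ (L *ᵥ z) + ε * (z ⬝ᵥ z) := by
      nth_rw 1 [← hy]
      rw [add_dotProduct, smul_dotProduct, smul_eq_mul, dotProduct_comm]
    have hyy : y ⬝ᵥ y = (L *ᵥ z) ⬝ᵥ (L *ᵥ z) + 2 * ε * (z ⬝ᵥ (L *ᵥ z)) + ε ^ 2 * (z ⬝ᵥ z) := by
      nth_rw 1 2 [← hy]
      simp only [add_dotProduct, dotProduct_add, smul_dotProduct, dotProduct_smul, smul_eq_mul]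
      rw [dotProduct_comm (L *ᵥ z) z]
      ring
    simp only [dotProduct_smul, dotProduct_sub, smul_eq_mul]
    have e1 : y ⬝ᵥ L *ᵥ y - ε * (y ⬝ᵥ y - ε * y ⬝ᵥ z) - y ⬝ᵥ L *ᵥ y
        = -(ε * (y ⬝ᵥ y - ε * y ⬝ᵥ z)) := by ring
    have e2 : 0 ≤ y ⬝ᵥ y - ε * y ⬝ᵥ z := by
      rw [hyy, hyz]
      nlinarith [mul_nonneg hε.le hn]
    have e3 : 0 ≤ ε * y ⬝ᵥ z := by
      rw [hyz]; positivity
    rw [e1, abs_neg, abs_of_nonneg (by positivity)]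
    exact mul_le_mul_of_nonneg_left (by linarith) hε.le
  rw [tendsto_iff_dist_tendsto_zero]
  have hlim : Tendsto (fun ε : ℝ => ε * (y ⬝ᵥ y)) (𝓝[>] 0) (𝓝 0) := by
    have : Tendsto (fun ε : ℝ => ε * (y ⬝ᵥ y)) (𝓝 0) (𝓝 (0 * (y ⬝ᵥ y))) :=
      (continuous_id.mul continuous_const).tendsto 0
    rw [zero_mul] at this
    exact this.mono_left nhdsWithin_le_nhds
  refine squeeze_zero' (Eventually.of_forall fun _ => dist_nonneg) ?_ hlim
  filter_upwards [self_mem_nhdsWithin] with ε hε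
  exact key ε hε

end Kron

/-! ### The damped swing equation: Lyapunov function, flow and uniqueness -/

section Swing

variable {G : Type*} [Fintype G] [DecidableEq G]

theorem hasDerivAt_dotProduct_mulVec (M : Matrix G G ℝ) {u v : ℝ → G → ℝ} {u' v' : G → ℝ} {t : ℝ}
    (hu : HasDerivAt u u' t) (hv : HasDerivAt v v' t) :
    HasDerivAt (fun s => u s ⬝ᵥ (M *ᵥ v s)) (u' ⬝ᵥ (M *ᵥ v t) + u t ⬝ᵥ (M *ᵥ v')) t := by
  rw [hasDerivAt_pi] at hu hv
  simp only [dotProduct, mulVec, ← Finset.sum_add_distrib]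
  exact HasDerivAt.fun_sum fun i _ =>
    (hu i).mul (HasDerivAt.fun_sum fun j _ => (hv j).const_mul (M i j))

theorem abs_dotProduct_mulVec_le (M : Matrix G G ℝ) (x y : G → ℝ) :
    |x ⬝ᵥ (M *ᵥ y)| ≤ (∑ i, ∑ j, |M i j|) * (x ⬝ᵥ x + y ⬝ᵥ y) := by
  have hx : ∀ (z : G → ℝ) i, z i ^ 2 ≤ z ⬝ᵥ z := fun z i => by
    rw [sq]
    exact Finset.single_le_sum (f := fun i => z i * z i) (fun k _ => mul_self_nonneg (z k))
      (Finset.mem_univ i)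
  simp only [dotProduct, mulVec, Finset.mul_sum, Finset.sum_mul]
  refine (Finset.abs_sum_le_sum_abs _ _).trans (Finset.sum_le_sum fun i _ => ?_)
  refine (Finset.abs_sum_le_sum_abs _ _).trans (Finset.sum_le_sum fun j _ => ?_)
  change _ ≤ |M i j| * (x ⬝ᵥ x + y ⬝ᵥ y)
  have h1 : |x i * (M i j * y j)| = |M i j| * (|x i| * |y j|) := by
    rw [abs_mul, abs_mul]; ring
  rw [h1]
  refine mul_le_mul_of_nonneg_left ?_ (abs_nonneg _)
  nlinarith [hx x i, hx y j, sq_nonneg (|x i| - |y j|), sq_abs (x i), sq_abs (y j),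
    sq_nonneg (x i), sq_nonneg (y j)]

theorem dotProduct_mulVec_comm {M : Matrix G G ℝ} (hM : M.IsHermitian) (x y : G → ℝ) :
    x ⬝ᵥ (M *ᵥ y) = y ⬝ᵥ (M *ᵥ x) := by
  have hMt : Mᵀ = M := by rw [← conjTranspose_eq_transpose_of_trivial]; exact hM
  nth_rw 1 [← hMt]
  rw [mulVec_transpose, dotProduct_comm, ← dotProduct_mulVec]

theorem dotProduct_self_nonneg' (x : G → ℝ) : 0 ≤ x ⬝ᵥ x := by
  simpa using dotProduct_star_self_nonneg x

/-- A nonnegative function with `f' ≤ -c f`, `c > 0`, tends to zero. -/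
theorem tendsto_zero_of_hasDerivAt_le_neg_mul {f f' : ℝ → ℝ} {c : ℝ} (hc : 0 < c)
    (hf : ∀ t, HasDerivAt f (f' t) t) (h0 : ∀ t, 0 ≤ f t) (h : ∀ t, f' t ≤ -(c * f t)) :
    Tendsto f atTop (𝓝 0) := by
  have hd : ∀ t, HasDerivAt (fun t => f t * Real.exp (c * t))
      (f' t * Real.exp (c * t) + f t * (Real.exp (c * t) * c)) t := fun t => by
    have := ((hasDerivAt_id t).const_mul c).exp
    simp only [id, mul_one] at this
    exact (hf t).mul this
  have ha : Antitone fun t => f t * Real.exp (c * t) := by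
    refine antitone_of_deriv_nonpos (fun t => (hd t).differentiableAt) fun t => ?_
    rw [(hd t).deriv]
    nlinarith [h t, Real.exp_pos (c * t)]
  have hle : ∀ t, 0 ≤ t → f t ≤ f 0 * Real.exp (-(c * t)) := by
    intro t ht
    have h1 := ha ht
    simp only [mul_zero, Real.exp_zero, mul_one] at h1
    rw [Real.exp_neg, ← div_eq_mul_inv, le_div_iff₀ (Real.exp_pos _)]
    exact h1
  have hlim : Tendsto (fun t => f 0 * Real.exp (-(c * t))) atTop (𝓝 0) := by
    have h1 : Tendsto (fun t : ℝ => -(c * t)) atTop atBot :=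
      tendsto_neg_atTop_atBot.comp (tendsto_id.const_mul_atTop hc)
    simpa using (Real.tendsto_exp_atBot.comp h1).const_mul (f 0)
  refine squeeze_zero' (Eventually.of_forall h0) ?_ hlim
  filter_upwards [eventually_ge_atTop 0] with t ht using hle t ht

/-- `∫₀^∞ φᵀ φ dt = Jᵀ K⁻¹ J / (2 d)` for `m φ'' = -d φ' - K φ`, `φ(0) = 0`, `m φ'(0) = J`. -/
theorem integral_dotProduct_self_of_swing {K : Matrix G G ℝ} (hK : K.PosDef) {m d : ℝ}
    (hm : 0 < m) (hd : 0 < d) {φ ω : ℝ → G → ℝ} {J : G → ℝ}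
    (hφ : ∀ t, HasDerivAt φ (ω t) t)
    (hω : ∀ t, HasDerivAt ω (m⁻¹ • (-(d • ω t) - K *ᵥ φ t)) t)
    (hφ0 : φ 0 = 0) (hω0 : ω 0 = m⁻¹ • J) :
    IntegrableOn (fun t => φ t ⬝ᵥ φ t) (Set.Ioi 0) ∧
      ∫ t in Set.Ioi (0 : ℝ), φ t ⬝ᵥ φ t = J ⬝ᵥ (K⁻¹ *ᵥ J) / (2 * d) := by
  have hKu : IsUnit K.det := (isUnit_iff_isUnit_det _).mp hK.isUnit
  have hM : K⁻¹.PosDef := hK.inv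
  have hMK : ∀ x : G → ℝ, K⁻¹ *ᵥ (K *ᵥ x) = x := fun x => by
    rw [mulVec_mulVec, nonsing_inv_mul _ hKu, one_mulVec]
  set M := K⁻¹ with hMdef
  have h1 : ∀ x y : G → ℝ, x ⬝ᵥ ((1 : Matrix G G ℝ) *ᵥ y) = x ⬝ᵥ y := fun x y => by
    rw [one_mulVec]
  -- Since (dφ + mω)' = -Kφ, the form (dφ + mω)ᵀ K⁻¹ (dφ + mω) / (2d) has derivative -φᵀφ - (m/d)
  -- φᵀω. Adding m φᵀφ / (2d) cancels the cross term.
  let F : ℝ → ℝ := fun t => d / 2 * (φ t ⬝ᵥ (M *ᵥ φ t))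
    + m / (2 * d) * (φ t ⬝ᵥ ((1 : Matrix G G ℝ) *ᵥ φ t))
    + m * (φ t ⬝ᵥ (M *ᵥ ω t)) + m ^ 2 / (2 * d) * (ω t ⬝ᵥ (M *ᵥ ω t))
  -- F' does not control ω, so F alone gives no decay rate. The mechanical energy E supplies the
  -- missing dissipation -d ωᵀω.
  let E : ℝ → ℝ := fun t => m / 2 * (ω t ⬝ᵥ ((1 : Matrix G G ℝ) *ᵥ ω t))
    + 1 / 2 * (φ t ⬝ᵥ (K *ᵥ φ t))
  have hF : ∀ t, HasDerivAt F (-(φ t ⬝ᵥ φ t)) t := by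
    intro t
    have := ((((hasDerivAt_dotProduct_mulVec M (hφ t) (hφ t)).const_mul (d / 2)).add
      ((hasDerivAt_dotProduct_mulVec 1 (hφ t) (hφ t)).const_mul (m / (2 * d)))).add
      ((hasDerivAt_dotProduct_mulVec M (hφ t) (hω t)).const_mul m)).add
      ((hasDerivAt_dotProduct_mulVec M (hω t) (hω t)).const_mul (m ^ 2 / (2 * d)))
    refine this.congr_deriv ?_
    simp only [h1, mulVec_smul, mulVec_sub, mulVec_neg, hMK, smul_dotProduct, dotProduct_smul,
      sub_dotProduct, neg_dotProduct, dotProduct_sub, dotProduct_neg, smul_eq_mul]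
    rw [dotProduct_mulVec_comm hM.1 (ω t) (φ t), dotProduct_mulVec_comm hM.1 (K *ᵥ φ t) (ω t),
      hMK, dotProduct_comm (φ t) (ω t)]
    field_simp
    ring
  have hE : ∀ t, HasDerivAt E (-(d * (ω t ⬝ᵥ ω t))) t := by
    intro t
    have := ((hasDerivAt_dotProduct_mulVec 1 (hω t) (hω t)).const_mul (m / 2)).add
      ((hasDerivAt_dotProduct_mulVec K (hφ t) (hφ t)).const_mul (1 / 2))
    refine this.congr_deriv ?_
    simp only [h1, smul_dotProduct, dotProduct_smul,
      sub_dotProduct, neg_dotProduct, dotProduct_sub, dotProduct_neg, smul_eq_mul]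
    rw [dotProduct_mulVec_comm hK.1 (φ t) (ω t), dotProduct_comm (K *ᵥ φ t) (ω t)]
    field_simp
    ring
  have hF0 : ∀ t, 0 ≤ F t := by
    intro t
    have h2 := hM.posSemidef.dotProduct_mulVec_nonneg (d • φ t + m • ω t)
    have h3 := dotProduct_self_nonneg' (φ t)
    have : F t = 1 / (2 * d) * ((d • φ t + m • ω t) ⬝ᵥ (M *ᵥ (d • φ t + m • ω t)))
        + m / (2 * d) * (φ t ⬝ᵥ φ t) := by
      simp only [F, h1, add_dotProduct, dotProduct_add, mulVec_add, mulVec_smul, smul_dotProduct,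
        dotProduct_smul, smul_eq_mul]
      rw [dotProduct_mulVec_comm hM.1 (ω t) (φ t)]
      field_simp
      ring
    rw [this]
    simp only [star_trivial] at h2
    positivity
  have hE0 : ∀ t, 0 ≤ E t := by
    intro t
    have h2 := hK.posSemidef.dotProduct_mulVec_nonneg (φ t)
    have h3 := dotProduct_self_nonneg' (ω t)
    simp only [star_trivial] at h2
    simp only [E, h1]
    positivity
  -- Any finite B suffices: it turns the dissipation of F + E into exponential decay at rate min 1 d
  -- / B.
  obtain ⟨B, hB, hBle⟩ : ∃ B, 0 < B ∧ ∀ t, F t + E t ≤ B * (φ t ⬝ᵥ φ t + ω t ⬝ᵥ ω t) := by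
    set a := ∑ i, ∑ j, |M i j| with ha
    set k := ∑ i, ∑ j, |K i j| with hk
    have ha0 : 0 ≤ a := Finset.sum_nonneg fun i _ => Finset.sum_nonneg fun j _ => abs_nonneg _
    have hk0 : 0 ≤ k := Finset.sum_nonneg fun i _ => Finset.sum_nonneg fun j _ => abs_nonneg _
    refine ⟨d * a + m / (2 * d) + m * a + m ^ 2 / d * a + m / 2 + k, by positivity, fun t => ?_⟩
    have hp := dotProduct_self_nonneg' (φ t)
    have hw := dotProduct_self_nonneg' (ω t)
    have b1 := (le_abs_self _).trans (abs_dotProduct_mulVec_le M (φ t) (φ t))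
    have b2 := (le_abs_self _).trans (abs_dotProduct_mulVec_le M (φ t) (ω t))
    have b3 := (le_abs_self _).trans (abs_dotProduct_mulVec_le M (ω t) (ω t))
    have b4 := (le_abs_self _).trans (abs_dotProduct_mulVec_le K (φ t) (φ t))
    rw [← ha] at b1 b2 b3
    rw [← hk] at b4
    simp only [F, E, h1]
    set p := φ t ⬝ᵥ φ t
    set w := ω t ⬝ᵥ ω t
    have c1 := mul_le_mul_of_nonneg_left b1 (by positivity : 0 ≤ d / 2)
    have c2 := mul_le_mul_of_nonneg_left b2 hm.le
    have c3 := mul_le_mul_of_nonneg_left b3 (by positivity : 0 ≤ m ^ 2 / (2 * d))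
    have e3 : m ^ 2 / (2 * d) * (a * (w + w)) = m ^ 2 / d * a * w := by field_simp; ring
    have q1 : 0 ≤ d * a * w := by positivity
    have q2 : 0 ≤ m / (2 * d) * w := by positivity
    have q3 : 0 ≤ m ^ 2 / d * a * p := by positivity
    have q4 : 0 ≤ m / 2 * p := by positivity
    have q5 : 0 ≤ k * w := by positivity
    rw [e3] at c3
    linarith
  have hlim : Tendsto F atTop (𝓝 0) := by
    have hmin : 0 < min 1 d := lt_min one_pos hd
    have := tendsto_zero_of_hasDerivAt_le_neg_mul (c := min 1 d / B) (by positivity)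
      (fun t => (hF t).add (hE t)) (fun t => add_nonneg (hF0 t) (hE0 t)) (fun t => by
        have hp := dotProduct_self_nonneg' (φ t)
        have hw := dotProduct_self_nonneg' (ω t)
        have h2 : min 1 d / B * (F t + E t) ≤ min 1 d * (φ t ⬝ᵥ φ t + ω t ⬝ᵥ ω t) := by
          rw [div_mul_eq_mul_div, div_le_iff₀ hB, mul_assoc]
          refine mul_le_mul_of_nonneg_left ?_ hmin.le
          rw [mul_comm _ B]
          exact hBle t
        have h3 := mul_le_mul_of_nonneg_right (min_le_left 1 d) hp
        have h4 := mul_le_mul_of_nonneg_right (min_le_right 1 d) hw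
        simp only [Pi.add_apply]
        linarith)
    exact squeeze_zero hF0 (fun t => le_add_of_nonneg_right (hE0 t)) this
  have hneg : ∀ t ∈ Set.Ioi (0 : ℝ), -(φ t ⬝ᵥ φ t) ≤ 0 := fun t _ =>
    neg_nonpos.mpr (dotProduct_self_nonneg' _)
  have hint := integrableOn_Ioi_deriv_of_nonpos' (fun t _ => hF t) hneg hlim
  have hval := integral_Ioi_of_hasDerivAt_of_nonpos' (fun t _ => hF t) hneg hlim
  refine ⟨by simpa using hint.neg, ?_⟩
  rw [integral_neg, zero_sub, neg_inj] at hval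
  rw [hval]
  simp only [F, hφ0, hω0, mulVec_smul, mulVec_zero, zero_dotProduct, smul_dotProduct,
    dotProduct_smul, smul_eq_mul]
  field_simp
  ring

/-- The vector field of the first order form of `m φ'' = -d φ' - K φ`. -/
def swingField (K : Matrix G G ℝ) (m d : ℝ) :
    (G → ℝ) × (G → ℝ) →L[ℝ] (G → ℝ) × (G → ℝ) :=
  LinearMap.toContinuousLinearMap
    ((LinearMap.snd ℝ (G → ℝ) (G → ℝ)).prod
      (m⁻¹ • (-(d • LinearMap.snd ℝ (G → ℝ) (G → ℝ)) -
        K.mulVecLin ∘ₗ LinearMap.fst ℝ (G → ℝ) (G → ℝ))))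

theorem swingField_apply (K : Matrix G G ℝ) (m d : ℝ) (x : (G → ℝ) × (G → ℝ)) :
    swingField K m d x = (x.2, m⁻¹ • (-(d • x.2) - K *ᵥ x.1)) := rfl

/-- The swing dynamics started with zero angles and momenta `J`. -/
def swingFlow (K : Matrix G G ℝ) (m d : ℝ) (J : G → ℝ) (t : ℝ) : (G → ℝ) × (G → ℝ) :=
  NormedSpace.exp (t • swingField K m d) (0, m⁻¹ • J)

theorem hasDerivAt_swingFlow (K : Matrix G G ℝ) (m d : ℝ) (J : G → ℝ) (t : ℝ) :
    HasDerivAt (swingFlow K m d J) (swingField K m d (swingFlow K m d J t)) t := by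
  have := (hasDerivAt_exp_smul_const' (𝕂 := ℝ) (swingField K m d) t).clm_apply
    (hasDerivAt_const t ((0 : G → ℝ), m⁻¹ • J))
  simp only [map_zero, add_zero] at this
  exact this

theorem swingFlow_zero (K : Matrix G G ℝ) (m d : ℝ) (J : G → ℝ) :
    swingFlow K m d J 0 = (0, m⁻¹ • J) := by
  simp [swingFlow]

theorem hasDerivAt_swingFlow_fst (K : Matrix G G ℝ) (m d : ℝ) (J : G → ℝ) (t : ℝ) :
    HasDerivAt (fun s => (swingFlow K m d J s).1) (swingFlow K m d J t).2 t :=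
  (hasDerivAt_swingFlow K m d J t).fst

theorem hasDerivAt_swingFlow_snd (K : Matrix G G ℝ) (m d : ℝ) (J : G → ℝ) (t : ℝ) :
    HasDerivAt (fun s => (swingFlow K m d J s).2)
      (m⁻¹ • (-(d • (swingFlow K m d J t).2) - K *ᵥ (swingFlow K m d J t).1)) t :=
  (hasDerivAt_swingFlow K m d J t).snd

theorem continuous_swingFlow (K : Matrix G G ℝ) (m d : ℝ) (J : G → ℝ) :
    Continuous (swingFlow K m d J) :=
  continuous_iff_continuousAt.mpr fun t => (hasDerivAt_swingFlow K m d J t).continuousAt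

theorem continuous_mulVec_comp (K : Matrix G G ℝ) {f : ℝ → G → ℝ} (hf : Continuous f) :
    Continuous fun t => K *ᵥ f t :=
  Continuous.matrix_mulVec continuous_const hf

/-- A solution of the integrated swing equation follows the swing flow. -/
theorem eq_swingFlow_of_integral_eq {K : Matrix G G ℝ} {m d : ℝ} (hm : 0 < m) {J : G → ℝ}
    {φ ω : ℝ → G → ℝ} (hloc : LocallyIntegrable ω)
    (hφ : ∀ t, 0 ≤ t → φ t = ∫ s in (0 : ℝ)..t, ω s)
    (hω : ∀ t, 0 ≤ t → m • ω t = (∫ s in (0 : ℝ)..t, (-(d • ω s) - K *ᵥ φ s)) + J)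
    {t : ℝ} (ht : 0 ≤ t) : (φ t, ω t) = swingFlow K m d J t := by
  have hωi : ∀ a b, IntervalIntegrable ω volume a b := fun a b => 
    (hloc.integrableOn_isCompact isCompact_uIcc).intervalIntegrable
  -- Regularity bootstrap: ω is only locally integrable, so φ₁ and ω₁ are continuous and φ₂ and ω₂
  -- differentiable. All are defined on the whole line but agree with φ and ω only for t ≥ 0, which
  -- is where uniqueness of solutions is applied.
  set φ₁ : ℝ → G → ℝ := fun t => ∫ s in (0 : ℝ)..t, ω s with hφ₁
  have hφ₁c : Continuous φ₁ := intervalIntegral.continuous_primitive hωi 0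
  have hKi : ∀ a b, IntervalIntegrable (fun s => K *ᵥ φ₁ s) volume a b := fun a b =>
    (continuous_mulVec_comp K hφ₁c).intervalIntegrable a b
  set ω₁ : ℝ → G → ℝ := fun t =>
    m⁻¹ • ((∫ s in (0 : ℝ)..t, (-(d • ω s) - K *ᵥ φ₁ s)) + J) with hω₁
  have hω₁c : Continuous ω₁ := by
    have : Continuous fun t => ∫ s in (0 : ℝ)..t, (-(d • ω s) - K *ᵥ φ₁ s) :=
      intervalIntegral.continuous_primitive
        (fun a b => (((hωi a b).smul d).neg).sub (hKi a b)) 0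
    exact (this.add continuous_const).const_smul m⁻¹
  have hφeq : ∀ s, 0 ≤ s → φ s = φ₁ s := hφ
  have hωeq : ∀ s, 0 ≤ s → ω s = ω₁ s := by
    intro s hs
    have h := hω s hs
    have hcongr : ∫ r in (0 : ℝ)..s, (-(d • ω r) - K *ᵥ φ r)
        = ∫ r in (0 : ℝ)..s, (-(d • ω r) - K *ᵥ φ₁ r) := by
      refine intervalIntegral.integral_congr fun r hr => ?_
      rw [Set.uIcc_of_le hs] at hr
      simp only [hφeq r hr.1]
    rw [hcongr] at h
    rw [hω₁]
    simp only [← h, smul_smul, inv_mul_cancel₀ hm.ne', one_smul]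
  set φ₂ : ℝ → G → ℝ := fun t => ∫ s in (0 : ℝ)..t, ω₁ s with hφ₂
  have hφ₂d : ∀ t, HasDerivAt φ₂ (ω₁ t) t := fun t => hω₁c.integral_hasStrictDerivAt 0 t |>.hasDerivAt
  have hφ₂c : Continuous φ₂ := continuous_iff_continuousAt.mpr fun t => (hφ₂d t).continuousAt
  have hφ₂eq : ∀ s, 0 ≤ s → φ₁ s = φ₂ s := by
    intro s hs
    refine intervalIntegral.integral_congr fun r hr => ?_
    rw [Set.uIcc_of_le hs] at hr
    exact hωeq r hr.1
  have hcont : Continuous fun s => -(d • ω₁ s) - K *ᵥ φ₂ s :=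
    ((hω₁c.const_smul d).neg).sub (continuous_mulVec_comp K hφ₂c)
  set ω₂ : ℝ → G → ℝ := fun t =>
    m⁻¹ • ((∫ s in (0 : ℝ)..t, (-(d • ω₁ s) - K *ᵥ φ₂ s)) + J) with hω₂
  have hω₂d : ∀ t, HasDerivAt ω₂ (m⁻¹ • (-(d • ω₁ t) - K *ᵥ φ₂ t)) t := fun t =>
    ((hcont.integral_hasStrictDerivAt 0 t).hasDerivAt.add_const J).const_smul m⁻¹
  have hω₂eq : ∀ s, 0 ≤ s → ω₁ s = ω₂ s := by
    intro s hs
    refine congrArg (fun x => m⁻¹ • (x + J)) (intervalIntegral.integral_congr fun r hr => ?_)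
    rw [Set.uIcc_of_le hs] at hr
    rw [hωeq r hr.1, hφ₂eq r hr.1]
  have hd : ∀ s, HasDerivAt (fun s => (φ₂ s, ω₂ s))
      (ω₁ s, m⁻¹ • (-(d • ω₁ s) - K *ᵥ φ₂ s)) s := fun s => (hφ₂d s).prodMk (hω₂d s)
  have huniq := ODE_solution_unique (f := fun s => (φ₂ s, ω₂ s)) (g := swingFlow K m d J)
    (v := fun _ => swingField K m d) (a := 0) (b := t)
    (fun _ => (swingField K m d).lipschitz)
    (fun s _ => (hd s).continuousAt.continuousWithinAt)
    (fun s hs => by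
      rw [swingField_apply]
      simp only [← hω₂eq s hs.1]
      exact (hd s).hasDerivWithinAt)
    (continuous_swingFlow K m d J).continuousOn
    (fun s _ => (hasDerivAt_swingFlow K m d J s).hasDerivWithinAt)
    (by simp [swingFlow_zero, hφ₂, hω₂])
  rw [hφeq t ht, hφ₂eq t ht, hωeq t ht, hω₂eq t ht]
  exact huniq ⟨ht, le_rfl⟩

theorem swingFlow_integral_eq (K : Matrix G G ℝ) {m : ℝ} (hm : 0 < m) (d : ℝ) (J : G → ℝ) (t : ℝ) :
    m • (swingFlow K m d J t).2 = (∫ s in (0 : ℝ)..t,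
      (-(d • (swingFlow K m d J s).2) - K *ᵥ (swingFlow K m d J s).1)) + J := by
  have hc := continuous_swingFlow K m d J
  have h := intervalIntegral.integral_eq_sub_of_hasDerivAt (a := 0) (b := t)
    (fun s _ => (hasDerivAt_swingFlow_snd K m d J s).const_smul m)
    (((((hc.snd.const_smul d).neg).sub (continuous_mulVec_comp K hc.fst)).const_smul m⁻¹).const_smul m
      |>.intervalIntegrable 0 t)
  simp only [smul_smul, mul_inv_cancel₀ hm.ne', one_smul, swingFlow_zero, Pi.smul_apply] at h
  rw [h]
  simp

end Swing

/-! ### Fault responses and their angle coherence -/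

section Response

variable {G C : Type*} [Fintype G] [Fintype C] [DecidableEq G] [DecidableEq C]

/-- The impulse transferred to the machines by the Dirac fault. -/
def faultImpulse (N : PowerNetwork (G ⊕ C)) (P θ : G ⊕ C → ℝ) (τ : ℝ) (i j : G ⊕ C) : G → ℝ :=
  τ • ((kronInjection (N.faultedLaplacian i j) P - kronInjection N.laplacian P)
    - (kronMatrix (N.faultedLaplacian i j) - kronMatrix N.laplacian) *ᵥ fun k => θ (Sum.inl k))

theorem diagonal_const_mulVec (c : ℝ) (x : G → ℝ) : diagonal (fun _ => c) *ᵥ x = c • x := by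
  ext k
  simp [mulVec_diagonal]

variable {N : PowerNetwork (G ⊕ C)} {P θ : G ⊕ C → ℝ} {m d τ ε : ℝ} {i j : G ⊕ C}

/-- The closed interval contains the atom at 0, even when t = 0. There φ vanishes, so the
state-dependent part of the fault contributes nothing. -/
theorem setIntegral_dirac_faultTerm {φ : ℝ → G → ℝ} (hφ : φ 0 = 0) {t : ℝ} (ht : 0 ≤ t) :
    ∫ s in Set.Icc (0 : ℝ) t,
        τ • ((kronInjection (N.faultedLaplacian i j) P - kronInjection N.laplacian P)
          - (kronMatrix (N.faultedLaplacian i j) - kronMatrix N.laplacian) *ᵥ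
              ((fun k => θ (Sum.inl k)) + φ s)) ∂(Measure.dirac (0 : ℝ)) =
      faultImpulse N P θ τ i j := by
  classical
  rw [setIntegral_dirac, if_pos ⟨le_rfl, ht⟩, hφ, add_zero, faultImpulse]

theorem IsFaultResponse.eq_swingFlow (hm : 0 < m) {φ ω : ℝ → G → ℝ}
    (h : IsFaultResponse N P θ (fun _ => m) (fun _ => d) τ i j ε φ ω) {t : ℝ} (ht : 0 ≤ t) :
    (φ t, ω t) = swingFlow (kronMatrix N.laplacian + ε • (1 : Matrix G G ℝ)) m d
      (faultImpulse N P θ τ i j) t := by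
  refine eq_swingFlow_of_integral_eq hm h.locallyIntegrable h.angle_eq (fun s hs => ?_) ht
  have h0 : φ 0 = 0 := by rw [h.angle_eq 0 le_rfl, intervalIntegral.integral_same]
  have := h.freq_eq s hs
  rw [setIntegral_dirac_faultTerm h0 hs] at this
  simpa only [diagonal_const_mulVec] using this

variable (N P θ d τ ε i j) in
-- Cutting off on the closed half-line puts the frequency jump J/m at time 0 itself, while the angle
-- starts from 0 and stays continuous.
theorem isFaultResponse_swingFlow (hm : 0 < m) :
    IsFaultResponse N P θ (fun _ => m) (fun _ => d) τ i j ε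
      ((Set.Ici 0).indicator fun t => (swingFlow (kronMatrix N.laplacian + ε • (1 : Matrix G G ℝ))
        m d (faultImpulse N P θ τ i j) t).1)
      ((Set.Ici 0).indicator fun t => (swingFlow (kronMatrix N.laplacian + ε • (1 : Matrix G G ℝ))
        m d (faultImpulse N P θ τ i j) t).2) := by
  set K := kronMatrix N.laplacian + ε • (1 : Matrix G G ℝ)
  set J := faultImpulse N P θ τ i j
  have hc := continuous_swingFlow K m d J
  have hnn : ∀ {t s : ℝ}, 0 ≤ t → s ∈ Set.uIcc 0 t → s ∈ Set.Ici (0 : ℝ) := by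
    intro t s ht hs
    rw [Set.uIcc_of_le ht] at hs
    exact hs.1
  refine ⟨fun t ht => Set.indicator_of_notMem (by simpa using ht) _,
    fun t ht => Set.indicator_of_notMem (by simpa using ht) _,
    hc.snd.locallyIntegrable.indicator measurableSet_Ici, fun t ht => ?_, fun t ht => ?_⟩
  · rw [Set.indicator_of_mem (Set.mem_Ici.mpr ht), intervalIntegral.integral_congr
      (g := fun s => (swingFlow K m d J s).2)
      (fun s hs => Set.indicator_of_mem (hnn ht hs) _),
      intervalIntegral.integral_eq_sub_of_hasDerivAt
        (fun s _ => hasDerivAt_swingFlow_fst K m d J s) (hc.snd.intervalIntegrable 0 t),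
      swingFlow_zero, sub_zero]
  · rw [setIntegral_dirac_faultTerm (by simp [swingFlow_zero]) ht]
    simp only [diagonal_const_mulVec]
    rw [Set.indicator_of_mem (Set.mem_Ici.mpr ht), swingFlow_integral_eq K hm]
    congr 1
    refine intervalIntegral.integral_congr fun s hs => ?_
    simp only [Set.indicator_of_mem (hnn ht hs)]
    rfl

theorem IsFaultResponse.unique (hm : 0 < m) {φ₁ ω₁ φ₂ ω₂ : ℝ → G → ℝ}
    (h₁ : IsFaultResponse N P θ (fun _ => m) (fun _ => d) τ i j ε φ₁ ω₁)
    (h₂ : IsFaultResponse N P θ (fun _ => m) (fun _ => d) τ i j ε φ₂ ω₂) (t : ℝ) :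
    (φ₁ t, ω₁ t) = (φ₂ t, ω₂ t) := by
  rcases lt_or_ge t 0 with ht | ht
  · rw [h₁.angle_before t ht, h₁.freq_before t ht, h₂.angle_before t ht, h₂.freq_before t ht]
  · rw [h₁.eq_swingFlow hm ht, h₂.eq_swingFlow hm ht]

theorem existsUnique_isFaultResponse (hm : 0 < m) :
    ∃! x : (ℝ → G → ℝ) × (ℝ → G → ℝ),
      IsFaultResponse N P θ (fun _ => m) (fun _ => d) τ i j ε x.1 x.2 := by
  have hex := isFaultResponse_swingFlow N P θ d τ ε i j hm
  exact ⟨(_, _), hex, fun x hx => Prod.ext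
    (funext fun t => congrArg Prod.fst (IsFaultResponse.unique hm hx hex t))
    (funext fun t => congrArg Prod.snd (IsFaultResponse.unique hm hx hex t))⟩

theorem IsFaultResponse.integral_dotProduct_self (hm : 0 < m) (hd : 0 < d)
    (hK : (kronMatrix N.laplacian + ε • (1 : Matrix G G ℝ)).PosDef) {φ ω : ℝ → G → ℝ}
    (h : IsFaultResponse N P θ (fun _ => m) (fun _ => d) τ i j ε φ ω) :
    IntegrableOn (fun t => φ t ⬝ᵥ φ t) (Set.Ioi 0) ∧
      angleCoherence φ = faultImpulse N P θ τ i j ⬝ᵥ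
        ((kronMatrix N.laplacian + ε • (1 : Matrix G G ℝ))⁻¹ *ᵥ faultImpulse N P θ τ i j) /
          (2 * d) := by
  set K := kronMatrix N.laplacian + ε • (1 : Matrix G G ℝ)
  set J := faultImpulse N P θ τ i j
  have hmain := integral_dotProduct_self_of_swing hK hm hd
    (hasDerivAt_swingFlow_fst K m d J) (hasDerivAt_swingFlow_snd K m d J)
    (by rw [swingFlow_zero]) (J := J) (by rw [swingFlow_zero])
  have heq : Set.EqOn (fun t => (swingFlow K m d J t).1 ⬝ᵥ (swingFlow K m d J t).1)
      (fun t => φ t ⬝ᵥ φ t) (Set.Ioi 0) := by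
    intro t ht
    simp only [K, J, ← h.eq_swingFlow hm (le_of_lt ht)]
  refine ⟨hmain.1.congr_fun heq measurableSet_Ioi, ?_⟩
  rw [angleCoherence, ← hmain.2]
  exact (setIntegral_congr_fun measurableSet_Ioi heq).symm

/-- The angle coherence of a non-splitting line fault, in terms of the passive part of
`e_(i,j)`. -/
theorem hasAngleCoherence_of_isNonsplittingLine [Nonempty G] (hP : P = N.laplacian *ᵥ θ)
    (hm : 0 < m) (hd : 0 < d) (τ : ℝ) (h : N.IsNonsplittingLine i j) :
    KronReducible N i j ∧
      1 - N.b i j * passiveForm N.laplacian (edgeVec i j) ≠ 0 ∧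
      HasAngleCoherence N P θ (fun _ => m) (fun _ => d) τ i j
        (N.lineFlow θ i j ^ 2 * τ ^ 2 / (2 * d) *
          ((N.resistanceDistance i j - passiveForm N.laplacian (edgeVec i j)) /
            (1 - N.b i j * passiveForm N.laplacian (edgeVec i j)) ^ 2)) := by
  have hN := N.connected_of_isNonsplittingLine h
  have hkr : KronReducible N i j := by
    refine ⟨(isUnit_iff_isUnit_det _).mp (N.passiveBlock_posDef hN).isUnit, ?_⟩
    rw [← N.laplacian_deleteLine h.1.ne]
    exact (isUnit_iff_isUnit_det _).mp
      ((N.deleteLine i j).passiveBlock_posDef (N.deleteLine_connected h)).isUnit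
  have hr := one_sub_mul_passiveForm_ne_zero N.laplacian (edgeVec i j) (N.b i j) hkr.1 hkr.2
  refine ⟨hkr, hr, fun ε _ => existsUnique_isFaultResponse hm, fun φ ω hφ => ?_⟩
  have hL := N.kronMatrix_laplacian_posSemidef hN
  have hK : ∀ ε : ℝ, 0 < ε → (kronMatrix N.laplacian + ε • (1 : Matrix G G ℝ)).PosDef :=
    fun ε hε => PosDef.posSemidef_add hL (PosDef.one.smul hε)
  have hint := fun (ε : ℝ) (hε : 0 < ε) =>
    (hφ ε hε).integral_dotProduct_self hm hd (hK ε hε)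
  refine ⟨fun ε hε => (hint ε hε).1, ?_⟩
  obtain ⟨y, hy, hyy⟩ := exists_kronMatrix_mulVec_eq N hN hkr.1 i j
  set r := passiveForm N.laplacian (edgeVec i j)
  -- Scale for which the impulse is L_red (c y). Being in the range of L_red is what keeps the limit
  -- ε → 0 finite.
  set c := τ * (N.lineFlow θ i j * (1 - N.b i j * r)⁻¹) with hc
  have hJ : faultImpulse N P θ τ i j = kronMatrix N.laplacian *ᵥ (c • y) := by
    rw [faultImpulse, hP, kronInjection_faulted_sub N θ hkr, smul_smul, mulVec_smul, hy]
  have hlim := (tendsto_dotProduct_inv_add_smul hL (c • y)).div_const (2 * d)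
  have hval : (c • y) ⬝ᵥ (kronMatrix N.laplacian *ᵥ (c • y)) / (2 * d) =
      N.lineFlow θ i j ^ 2 * τ ^ 2 / (2 * d) *
          ((N.resistanceDistance i j - r) / (1 - N.b i j * r) ^ 2) := by
    rw [mulVec_smul, smul_dotProduct, dotProduct_smul, hyy, hc, smul_eq_mul, smul_eq_mul]
    field_simp
  rw [hval] at hlim
  refine hlim.congr' ?_
  filter_upwards [self_mem_nhdsWithin] with ε hε
  rw [(hint ε hε).2, hJ]

theorem passiveForm_edgeVec_inl_inl (A : Matrix (G ⊕ C) (G ⊕ C) ℝ) (α β : G) :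
    passiveForm A (edgeVec (Sum.inl α) (Sum.inl β)) = 0 := by
  have : (fun k : C => edgeVec (Sum.inl α : G ⊕ C) (Sum.inl β) (Sum.inr k)) = 0 := by
    ext k; simp [edgeVec]
  rw [passiveForm, this, zero_dotProduct]

theorem passiveForm_edgeVec_inr_inr (A : Matrix (G ⊕ C) (G ⊕ C) ℝ) (α β : C) :
    passiveForm A (edgeVec (Sum.inr α) (Sum.inr β)) =
      edgeVec α β ⬝ᵥ (A.toBlocks₂₂⁻¹ *ᵥ edgeVec α β) := by
  have : (fun k : C => edgeVec (Sum.inr α : G ⊕ C) (Sum.inr β) (Sum.inr k)) = edgeVec α β := by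
    ext k; simp [edgeVec, Pi.single_apply]
  rw [passiveForm, this]

/-- Only the endpoint β is passive, and its sign -1 drops out of the quadratic form. -/
theorem passiveForm_edgeVec_inl_inr (A : Matrix (G ⊕ C) (G ⊕ C) ℝ) (α : G) (β : C) :
    passiveForm A (edgeVec (Sum.inl α) (Sum.inr β)) = A.toBlocks₂₂⁻¹ β β := by
  have : (fun k : C => edgeVec (Sum.inl α : G ⊕ C) (Sum.inr β) (Sum.inr k)) =
      -Pi.single β 1 := by
    ext k; simp [edgeVec, Pi.single_apply]
  rw [passiveForm, this]
  simp [mulVec_neg]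

end Response

end KronSwing
end

/-! ### The three types of line -/

theorem proposition7 {G C : Type*} [Fintype G] [Fintype C] [DecidableEq G] [DecidableEq C]
    [Nonempty G] (N : KronSwing.PowerNetwork (G ⊕ C)) (P θ : G ⊕ C → ℝ)
    (hP : P = N.laplacian *ᵥ θ) (d γ τ : ℝ) (hd : 0 < d) (hγ : 0 < γ) :
    -- both ends are synchronous machines
    (∀ α β : G, N.IsNonsplittingLine (Sum.inl α) (Sum.inl β) →
      KronSwing.KronReducible N (Sum.inl α) (Sum.inl β) ∧
      KronSwing.HasAngleCoherence N P θ (fun _ => d / γ) (fun _ => d) τ (Sum.inl α) (Sum.inl β)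
        (N.lineFlow θ (Sum.inl α) (Sum.inl β) ^ 2 * τ ^ 2 / (2 * d) *
          N.resistanceDistance (Sum.inl α) (Sum.inl β))) ∧
    -- both ends are passive
    (∀ α β : C, N.IsNonsplittingLine (Sum.inr α) (Sum.inr β) →
      KronSwing.KronReducible N (Sum.inr α) (Sum.inr β) ∧
      1 - N.b (Sum.inr α) (Sum.inr β) *
        (KronSwing.edgeVec α β ⬝ᵥ
          (N.laplacian.toBlocks₂₂⁻¹ *ᵥ KronSwing.edgeVec α β)) ≠ 0 ∧
      KronSwing.HasAngleCoherence N P θ (fun _ => d / γ) (fun _ => d) τ (Sum.inr α) (Sum.inr β)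
        (N.lineFlow θ (Sum.inr α) (Sum.inr β) ^ 2 * τ ^ 2 / (2 * d) *
          ((N.resistanceDistance (Sum.inr α) (Sum.inr β) -
              KronSwing.edgeVec α β ⬝ᵥ
                (N.laplacian.toBlocks₂₂⁻¹ *ᵥ KronSwing.edgeVec α β)) /
            (1 - N.b (Sum.inr α) (Sum.inr β) *
              (KronSwing.edgeVec α β ⬝ᵥ
                (N.laplacian.toBlocks₂₂⁻¹ *ᵥ KronSwing.edgeVec α β))) ^ 2))) ∧
    -- the end `α` is a synchronous machine and the end `β` is passive
    (∀ (α : G) (β : C), N.IsNonsplittingLine (Sum.inl α) (Sum.inr β) →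
      KronSwing.KronReducible N (Sum.inl α) (Sum.inr β) ∧
      1 - N.b (Sum.inl α) (Sum.inr β) * N.laplacian.toBlocks₂₂⁻¹ β β ≠ 0 ∧
      KronSwing.HasAngleCoherence N P θ (fun _ => d / γ) (fun _ => d) τ (Sum.inl α) (Sum.inr β)
        (N.lineFlow θ (Sum.inl α) (Sum.inr β) ^ 2 * τ ^ 2 / (2 * d) *
          ((N.resistanceDistance (Sum.inl α) (Sum.inr β) -
              N.laplacian.toBlocks₂₂⁻¹ β β) /
            (1 - N.b (Sum.inl α) (Sum.inr β) * N.laplacian.toBlocks₂₂⁻¹ β β) ^ 2))) := by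
  have hm : 0 < d / γ := div_pos hd hγ
  refine ⟨fun α β h => ?_, fun α β h => ?_, fun α β h => ?_⟩
  · obtain ⟨h1, -, h2⟩ := KronSwing.hasAngleCoherence_of_isNonsplittingLine hP hm hd τ h
    -- The edge vector has no passive part, so r = 0 and the denominator is 1.
    rw [KronSwing.passiveForm_edgeVec_inl_inl] at h2
    exact ⟨h1, by simpa using h2⟩
  · rw [← KronSwing.passiveForm_edgeVec_inr_inr]
    exact KronSwing.hasAngleCoherence_of_isNonsplittingLine hP hm hd τ h
  · rw [← KronSwing.passiveForm_edgeVec_inl_inr _ α]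
    exact KronSwing.hasAngleCoherence_of_isNonsplittingLine hP hm hd τ h
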